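/- **Setting.** Let $n\ge 0$. A *cube* in $\mathbb R^n$ is an axis-parallel box $\prod_i [a_i,b_i]$ with $a_i<b_i$; its faces are the usual ones. A *cubical decomposition* of a cube $C$ is a finite family of $n$-dimensional cubes $C_i$ with $C=\bigcup_i C_i$, whose interiors are pairwise disjoint and any two of which are disjoint or intersect in a common face. The polytope $\tilde C$ is $C$ with the following faces and vertices: its proper faces are the faces of the $C_i$ that lie on proper faces of $C$, and its vertices are those of $C$ and those vertices of the $C_i$ that lie on proper faces of $C$. **Index.** For a labeling $\lambda$ of points by $\{1,\dots,n+1\}$, the oriented index of a $k$-dimensional polytope $P$ (a face of some $C_i$, a cube $C_i$, or $\tilde C$) with vertex set $V(P)$ is defined recursively. It is $0$ if $\lambda(V(P))\ne\{1,\dots,k+1\}$. Otherwise $\mathrm{ind}_P(\lambda)=1$ if $k=0$, and $\mathrm{ind}_P(\lambda)=\sum_S \pm\,\mathrm{ind}_S(\lambda)$ if $k>0$, the sum being over the $(k-1)$-dimensional faces $S$ of $P$, with the sign comparing the chosen orientation of $S$ with the one induced by $P$. **Vector labels.** For $\ell\in\{\pm1\}^n$ let $\mathcal O_\ell=\{x\in\mathbb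 R^n : \ell_i x_i\ge 0\ \forall i\}$. A set of vector labels is *complete* if it contains $n+1$ different labels $\ell_1,\dots,\ell_{n+1}$ with $\mathcal O_{\ell_1}\cap\dots\cap\mathcal O_{\ell_{n+1}}=\{0\}$. A vector labeling $\varphi$ of points by $\{\pm1\}^n$ is *non-degenerate* on $\tilde C$ if for no proper face of $\tilde C$ the labels of its vertices form a complete set. A cube is *completely labeled* if the labels of its vertices form a complete set. **Change of labels.** A special convex polyhedral cone partition is a family of $n+1$ sets $\mathcal N_1,\dots,\mathcal N_{n+1}$, each an intersection of finitely many half-spaces $\{x_k\ge0\}$ or $\{x_k\le0\}$, with union $\mathbb R^n$, pairwise disjoint interiors and $\bigcap_j\mathcal N_j=\{0\}$. The associated change of labels $\psi:\{\pm1\}^n\to\{1,\dots,n+1\}$ sends $\ell$ to the unique $j$ with $\mathcal O_\ell\subseteq\mathcal N_j$. The index of a vector labeling $\varphi$, relative to $\psi$ and up to sign, is $\mathrm{ind}_P(\varphi)=\pm\,\mathrm{ind}_P(\psi\circ\varphi)$. **Theorem (Sperner's Lemma for cubical complexes).** Let $C$ be a cube with a cubical decomposition $\{C_i\}$, let $\tilde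 C$ be the corresponding polytope, let $\varphi$ be a vector labeling that is non-degenerate on $\tilde C$, and let $\psi$ be any change of labels. If $\mathrm{ind}_{\tilde C}(\varphi)=\pm\,\mathrm{ind}_{\tilde C}(\psi\circ\varphi)\neq0$, then there is a cube $C_i$ with $\mathrm{ind}_{C_i}(\varphi)=\pm\,\mathrm{ind}_{C_i}(\psi\circ\varphi)\ne0$, and this $C_i$ is completely labeled by $\varphi$; in particular the hyperoctants of the labels of its vertices meet only at $0$. -/

import Mathlib

namespace CubicalSperner

open BoxIntegral

/-! ### Cubes and their faces

An `n`-dimensional cube is an axis-parallel closed box `∏ [a i, b i]` with `a i < b i`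
(`BoxIntegral.Box`, of which only the closed box `Box.Icc` is used).  A nonempty face is coded by
`s : Fin n → SignType`: coordinate `i` is free if `s i = 0`, it equals `b i` if `s i = 1` and
`a i` if `s i = -1`.  The code `0` is the whole cube, all the other codes are proper faces. -/

/-- The face of the cube `I` with code `s`, as a set. -/
def faceSet {n : ℕ} (I : Box (Fin n)) (s : Fin n → SignType) : Set (Fin n → ℝ) :=
  {x | x ∈ Box.Icc I ∧ ∀ i, (s i = 1 → x i = I.upper i) ∧ (s i = -1 → x i = I.lower i)}

/-- The vertices of the face of `I` with code `s`. -/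
def faceVertices {n : ℕ} (I : Box (Fin n)) (s : Fin n → SignType) : Set (Fin n → ℝ) :=
  {v | v ∈ faceSet I s ∧ ∀ i, v i = I.lower i ∨ v i = I.upper i}

/-- A set lies on some proper face of the cube `C`. -/
def LiesOnProperFace {n : ℕ} (C : Box (Fin n)) (A : Set (Fin n → ℝ)) : Prop :=
  ∃ t : Fin n → SignType, t ≠ 0 ∧ A ⊆ faceSet C t

/-- A cubical decomposition of the cube `C`: finitely many `n`-dimensional cubes with union `C`,
with pairwise disjoint interiors, any two of which are disjoint or meet in a common face. -/
structure IsCubicalDecomposition {n : ℕ} (C : Box (Fin n)) (cells : Finset (Box (Fin n))) :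
    Prop where
  iUnion_eq : (⋃ I ∈ cells, Box.Icc I) = Box.Icc C
  interior_disjoint : ∀ I ∈ cells, ∀ J ∈ cells, I ≠ J →
    interior (Box.Icc I) ∩ interior (Box.Icc J) = ∅
  inter_face : ∀ I ∈ cells, ∀ J ∈ cells, I ≠ J →
    Box.Icc I ∩ Box.Icc J = ∅ ∨
      ∃ s t : Fin n → SignType,
        Box.Icc I ∩ Box.Icc J = faceSet I s ∧ Box.Icc I ∩ Box.Icc J = faceSet J t

/-! ### The oriented index of a labeling by `n + 1` labels

The labels `1, …, n + 1` are represented by `0, …, n` in `Fin (n + 1)`. -/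

/-- Every face is oriented by its free coordinates in increasing order.  `orient s i ε` is the sign
relating this orientation of the facet `s i = ε` of the face `s` (where `i` is free in `s`) to the
orientation induced on that facet by the face `s`.  The induced orientation is normalized by
appending the inner normal `-ε eᵢ` as the last vector. -/
def orient {n : ℕ} (s : Fin n → SignType) (i : Fin n) (ε : SignType) : ℤ :=
  -(ε : ℤ) * (-1) ^ (Finset.univ.filter fun j => s j = 0 ∧ i < j).card

open Classical in
/-- The oriented index of the labeling `lab` on the `k`-dimensional face `s` of the cube `I`
(`k` has to be the number of free coordinates of `s`): it is `0` unless the labels of the vertices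
are exactly the first `k + 1` labels, in which case it is `1` if `k = 0`, and the
sum of the indices of the `(k - 1)`-dimensional faces, counted with orientation, if `k > 0`.
For `k = 1` this gives `1` if the label increases along the edge, and `-1` if it decreases. -/
noncomputable def faceIndex {n : ℕ} (I : Box (Fin n)) (lab : (Fin n → ℝ) → Fin (n + 1)) :
    ℕ → (Fin n → SignType) → ℤ
  | 0, s => if lab '' faceVertices I s = {j : Fin (n + 1) | (j : ℕ) ≤ 0} then 1 else 0
  | k + 1, s =>
    if lab '' faceVertices I s = {j : Fin (n + 1) | (j : ℕ) ≤ k + 1} then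
      ∑ i ∈ Finset.univ.filter (fun i => s i = 0), ∑ ε ∈ ({1, -1} : Finset SignType),
        orient s i ε * faceIndex I lab k (Function.update s i ε)
    else 0

/-- The oriented index of the labeling `lab` on the `n`-dimensional cube `I`. -/
noncomputable def cubeIndex {n : ℕ} (I : Box (Fin n)) (lab : (Fin n → ℝ) → Fin (n + 1)) : ℤ :=
  faceIndex I lab n 0

/-! ### The polytope `C̃` of a decomposed cube

Its vertices are the vertices of `C` together with the vertices of the cells that lie on proper
faces of `C`; its proper faces are the faces of the cells that lie on proper faces of `C`. -/

/-- The vertices of `C̃`. -/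
def tildeVertices {n : ℕ} (C : Box (Fin n)) (cells : Finset (Box (Fin n))) : Set (Fin n → ℝ) :=
  faceVertices C 0 ∪ {v | (∃ I ∈ cells, v ∈ faceVertices I 0) ∧ LiesOnProperFace C {v}}

open Classical in
/-- The oriented index of `lab` on `C̃`: it is `0` unless the vertices of `C̃` carry all the labels
`1, …, n + 1`, in which case it is the sum of the indices of the
`(n - 1)`-dimensional faces of `C̃`, counted with orientation (and `1` if `n = 0`).
An `(n - 1)`-dimensional face of `C̃` is a facet of exactly one cell. -/
noncomputable def tildeIndex {n : ℕ} (C : Box (Fin n)) (cells : Finset (Box (Fin n)))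
    (lab : (Fin n → ℝ) → Fin (n + 1)) : ℤ :=
  if lab '' tildeVertices C cells = Set.univ then
    if n = 0 then 1
    else
      ∑ I ∈ cells, ∑ i : Fin n, ∑ ε ∈ ({1, -1} : Finset SignType),
        if LiesOnProperFace C (faceSet I (Function.update 0 i ε)) then
          orient 0 i ε * faceIndex I lab (n - 1) (Function.update 0 i ε)
        else 0
  else 0

/-! ### Vector labels -/

/-- Vector labels: elements of `{±1}ⁿ`. -/
abbrev VecLabel (n : ℕ) : Type := Fin n → ℤˣ

/-- The closed hyperoctant of a vector label. -/
def octant {n : ℕ} (l : VecLabel n) : Set (Fin n → ℝ) :=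
  {x | ∀ i, 0 ≤ (((l i : ℤˣ) : ℤ) : ℝ) * x i}

/-- A set of vector labels contains a complete collection: `n + 1` different labels whose
hyperoctants meet only at the origin. -/
def CarriesComplete {n : ℕ} (L : Set (VecLabel n)) : Prop :=
  ∃ l : Fin (n + 1) → VecLabel n,
    Function.Injective l ∧ (∀ j, l j ∈ L) ∧ (⋂ j, octant (l j)) = {0}

/-- A vector labeling of the polytope `C̃` is non-degenerate if no proper face of `C̃` carries a
complete collection of labels. -/
def NonDegenerate {n : ℕ} (C : Box (Fin n)) (cells : Finset (Box (Fin n)))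
    (φ : (Fin n → ℝ) → VecLabel n) : Prop :=
  ∀ I ∈ cells, ∀ s : Fin n → SignType, LiesOnProperFace C (faceSet I s) →
    ¬ CarriesComplete (φ '' faceVertices I s)

/-- The cube `I` is completely labeled by `φ`. -/
def CompletelyLabeled {n : ℕ} (I : Box (Fin n)) (φ : (Fin n → ℝ) → VecLabel n) : Prop :=
  CarriesComplete (φ '' faceVertices I 0)

/-- A convex polyhedral cone bounded by coordinate hyperplanes: an intersection of finitely many
half-spaces `x k ≥ 0` or `x k ≤ 0`. -/
def IsPolyhedralCone {n : ℕ} (K : Set (Fin n → ℝ)) : Prop :=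
  ∃ H : Finset (Fin n × ℤˣ), K = {x | ∀ h ∈ H, 0 ≤ (((h.2 : ℤˣ) : ℤ) : ℝ) * x h.1}

/-- A special convex polyhedral cone partition of `ℝⁿ`. -/
structure IsSpecialPartition {n : ℕ} (N : Fin (n + 1) → Set (Fin n → ℝ)) : Prop where
  cone : ∀ j, IsPolyhedralCone (N j)
  iUnion_eq : (⋃ j, N j) = Set.univ
  interior_disjoint : ∀ j l, j ≠ l → interior (N j) ∩ interior (N l) = ∅
  iInter_eq : (⋂ j, N j) = {0}

/-- `ψ : {±1}ⁿ → {1, …, n + 1}` is the change of labels of some special partition: it sends a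
vector label to the index of the only cone that contains its hyperoctant. -/
def IsChangeOfLabels {n : ℕ} (ψ : VecLabel n → Fin (n + 1)) : Prop :=
  ∃ N : Fin (n + 1) → Set (Fin n → ℝ), IsSpecialPartition N ∧
    ∀ l j, octant l ⊆ N j ↔ ψ l = j

end CubicalSperner

/-! The index is additive: when all labels occur among the vertices of `C̃`, its index is the sum of
the indices of the cells (`sum_cubeIndex_eq_tildeIndex`), so a nonzero index passes to some cell.

Additivity is a boundary argument. A cell's index must equal its signed facet sum even when some
label is missing and the definition truncates to 0. `faceIndex_succ` shows that this sum is then 0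
anyway, because the boundary of a boundary vanishes. Adding over the cells, each facet not on the
boundary of `C` occurs twice with opposite signs (`exists_opposite`), and the remaining facets give
the index of `C̃`.

A cell of nonzero index has vertices with all `n + 1` values of `ψ ∘ φ`; the corresponding
hyperoctants lie one in each cone of the partition, hence meet only at 0. -/

namespace CubicalSperner

open BoxIntegral Filter Topology

variable {n : ℕ}

/-! ### Faces as order intervals -/

/-- The lower corner of the face of `I` with code `s`. -/
def faceLower (I : Box (Fin n)) (s : Fin n → SignType) (i : Fin n) : ℝ :=
  if s i = 1 then I.upper i else I.lower i

/-- The upper corner of the face of `I` with code `s`. -/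
def faceUpper (I : Box (Fin n)) (s : Fin n → SignType) (i : Fin n) : ℝ :=
  if s i = -1 then I.lower i else I.upper i

lemma faceLower_le_faceUpper (I : Box (Fin n)) (s : Fin n → SignType) :
    faceLower I s ≤ faceUpper I s := by
  intro i
  have := I.lower_lt_upper i
  simp only [faceLower, faceUpper]
  rcases s i with _ | _ | _ <;> simp [this.le]

/-- Reads the free coordinates off the corners, so they do not depend on the cell through which a
face is described. -/
lemma faceLower_lt_faceUpper_iff (I : Box (Fin n)) (s : Fin n → SignType) (i : Fin n) :
    faceLower I s i < faceUpper I s i ↔ s i = 0 := by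
  have := I.lower_lt_upper i
  simp only [faceLower, faceUpper]
  rcases s i with _ | _ | _ <;> simp [this]

lemma mem_Icc_iff (I : Box (Fin n)) (x : Fin n → ℝ) :
    x ∈ Box.Icc I ↔ ∀ i, I.lower i ≤ x i ∧ x i ≤ I.upper i := by
  rw [Box.Icc_def, Set.mem_Icc, Pi.le_def, Pi.le_def, ← forall_and]

lemma faceSet_eq_Icc (I : Box (Fin n)) (s : Fin n → SignType) :
    faceSet I s = Set.Icc (faceLower I s) (faceUpper I s) := by
  ext x
  simp only [faceSet, Set.mem_ofPred_eq, mem_Icc_iff, Set.mem_Icc, Pi.le_def, ← forall_and]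
  refine forall_congr' fun i => ?_
  have := I.lower_lt_upper i
  simp only [faceLower, faceUpper]
  rcases s i with _ | _ | _ <;> simp <;> grind

lemma faceVertices_eq (I : Box (Fin n)) (s : Fin n → SignType) :
    faceVertices I s = {v | ∀ i, v i = faceLower I s i ∨ v i = faceUpper I s i} := by
  ext x
  simp only [faceVertices, faceSet_eq_Icc, Set.mem_ofPred_eq, Set.mem_Icc, Pi.le_def, ← forall_and]
  refine forall_congr' fun i => ?_
  have := I.lower_lt_upper i
  simp only [faceLower, faceUpper]
  rcases s i with _ | _ | _ <;> simp <;> grind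

lemma faceVertices_nonempty (I : Box (Fin n)) (s : Fin n → SignType) :
    (faceVertices I s).Nonempty := by
  rw [faceVertices_eq]
  exact ⟨faceLower I s, fun i => Or.inl rfl⟩

lemma faceVertices_update_subset (I : Box (Fin n)) {s : Fin n → SignType} {i : Fin n}
    (hi : s i = 0) (ε : SignType) :
    faceVertices I (Function.update s i ε) ⊆ faceVertices I s := by
  rintro v ⟨⟨h1, h2⟩, h3⟩
  refine ⟨⟨h1, fun j => ?_⟩, h3⟩
  have := h2 j
  by_cases hj : j = i
  · subst hj
    simp [hi]
  · simpa [Function.update_of_ne hj] using this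

lemma faceLower_eq_and_faceUpper_eq {I J : Box (Fin n)} {s t : Fin n → SignType}
    (h : faceSet I s = faceSet J t) :
    faceLower I s = faceLower J t ∧ faceUpper I s = faceUpper J t := by
  rw [faceSet_eq_Icc, faceSet_eq_Icc] at h
  have h1 := (Set.Icc_subset_Icc_iff (faceLower_le_faceUpper I s)).1 h.subset
  have h2 := (Set.Icc_subset_Icc_iff (faceLower_le_faceUpper J t)).1 h.superset
  exact ⟨le_antisymm h2.1 h1.1, le_antisymm h1.2 h2.2⟩

/-! ### The index of a face -/

/-- The sum of the indices of the facets of a face, counted with orientation. -/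
noncomputable def facetSum (I : Box (Fin n)) (lab : (Fin n → ℝ) → Fin (n + 1)) (k : ℕ)
    (s : Fin n → SignType) : ℤ :=
  ∑ i ∈ Finset.univ.filter (fun i => s i = 0), ∑ ε ∈ ({1, -1} : Finset SignType),
    orient s i ε * faceIndex I lab k (Function.update s i ε)

lemma faceIndex_succ_of_eq {I : Box (Fin n)} {lab : (Fin n → ℝ) → Fin (n + 1)} {k : ℕ}
    {s : Fin n → SignType}
    (h : lab '' faceVertices I s = {j : Fin (n + 1) | (j : ℕ) ≤ k + 1}) :
    faceIndex I lab (k + 1) s = facetSum I lab k s := by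
  rw [faceIndex, if_pos h, facetSum]

lemma faceIndex_eq_zero {I : Box (Fin n)} {lab : (Fin n → ℝ) → Fin (n + 1)} {k : ℕ}
    {s : Fin n → SignType}
    (h : lab '' faceVertices I s ≠ {j : Fin (n + 1) | (j : ℕ) ≤ k}) :
    faceIndex I lab k s = 0 := by
  cases k <;> rw [faceIndex, if_neg h]

lemma orient_neg (s : Fin n → SignType) (i : Fin n) (ε : SignType) :
    orient s i (-ε) = -orient s i ε := by
  simp [orient]

lemma orient_congr {s t : Fin n → SignType} (h : ∀ j, s j = 0 ↔ t j = 0) (i : Fin n)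
    (ε : SignType) : orient s i ε = orient t i ε := by
  simp [orient, h]

/-- Labels see only the vertices and `orient` only the free coordinates; both are determined by the
corners. Hence a face shared by two cells has the same index in each. -/
lemma faceIndex_congr {I J : Box (Fin n)} (lab : (Fin n → ℝ) → Fin (n + 1)) (k : ℕ)
    {s t : Fin n → SignType} (hl : faceLower I s = faceLower J t)
    (hu : faceUpper I s = faceUpper J t) : faceIndex I lab k s = faceIndex J lab k t := by
  induction k generalizing s t with
  | zero => simp only [faceIndex, faceVertices_eq, hl, hu]
  | succ k ih =>
    have hv : faceVertices I s = faceVertices J t := by simp only [faceVertices_eq, hl, hu]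
    have hst : ∀ j, s j = 0 ↔ t j = 0 := fun j => by
      rw [← faceLower_lt_faceUpper_iff I, ← faceLower_lt_faceUpper_iff J, hl, hu]
    by_cases h : lab '' faceVertices I s = {j : Fin (n + 1) | (j : ℕ) ≤ k + 1}
    · rw [faceIndex_succ_of_eq h, faceIndex_succ_of_eq (hv ▸ h), facetSum, facetSum]
      simp only [hst]
      refine Finset.sum_congr rfl fun i hi => Finset.sum_congr rfl fun ε _ => ?_
      have hti : t i = 0 := (Finset.mem_filter.1 hi).2
      have hsi := (hst i).2 hti
      have hli := congrFun hl i
      have hui := congrFun hu i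
      rw [faceLower, faceLower, if_neg (by simp [hsi]), if_neg (by simp [hti])] at hli
      rw [faceUpper, faceUpper, if_neg (by simp [hsi]), if_neg (by simp [hti])] at hui
      rw [orient_congr hst, ih]
      · funext j
        by_cases hj : j = i
        · subst hj; simp [faceLower, hli, hui]
        · simpa [faceLower, Function.update_of_ne hj] using congrFun hl j
      · funext j
        by_cases hj : j = i
        · subst hj; simp [faceUpper, hli, hui]
        · simpa [faceUpper, Function.update_of_ne hj] using congrFun hu j
    · rw [faceIndex_eq_zero h, faceIndex_eq_zero (hv ▸ h)]

/-- For `i < j`, fixing `i` first does not change the count of free coordinates above `j`, whereas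
fixing `j` first removes one free coordinate above `i`: exactly one sign changes. -/
lemma orient_mul_orient_swap {s : Fin n → SignType} {i j : Fin n} (hi : s i = 0) (hj : s j = 0)
    (hij : i ≠ j) {ε δ : SignType} (hε : ε ≠ 0) (hδ : δ ≠ 0) :
    orient s i ε * orient (Function.update s i ε) j δ =
      -(orient s j δ * orient (Function.update s j δ) i ε) := by
  wlog hlt : i < j generalizing i j ε δ
  · rw [this hj hi hij.symm hδ hε (lt_of_le_of_ne (not_lt.1 hlt) hij.symm), neg_neg]
  have h1 : (Finset.univ.filter fun l => Function.update s i ε l = 0 ∧ j < l) =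
      Finset.univ.filter fun l => s l = 0 ∧ j < l := by
    refine Finset.filter_congr fun l _ => and_congr_left fun hl => ?_
    rw [Function.update_of_ne (hlt.trans hl).ne']
  have h2 : (Finset.univ.filter fun l => s l = 0 ∧ i < l) =
      insert j (Finset.univ.filter fun l => Function.update s j δ l = 0 ∧ i < l) := by
    ext l
    by_cases hl : l = j
    · subst hl; simp [hj, hlt]
    · simp [hl]
  have h3 : j ∉ Finset.univ.filter fun l => Function.update s j δ l = 0 ∧ i < l := by
    simp [hδ]
  simp only [orient, h1, h2, Finset.card_insert_of_notMem h3, pow_succ]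
  ring

lemma mem_pairs {s : Fin n → SignType} {i j : Fin n} {ε δ : SignType}
    (hx : (⟨(i, ε), (j, δ)⟩ : (_ : Fin n × SignType) × (Fin n × SignType)) ∈
      (Finset.univ.filter (fun i => s i = 0) ×ˢ ({1, -1} : Finset SignType)).sigma fun x =>
        Finset.univ.filter (fun j => Function.update s x.1 x.2 j = 0) ×ˢ
          ({1, -1} : Finset SignType)) :
    s i = 0 ∧ ε ≠ 0 ∧ Function.update s i ε j = 0 ∧ δ ≠ 0 ∧ i ≠ j ∧ s j = 0 := by
  simp only [Finset.mem_sigma, Finset.mem_product, Finset.mem_filter, Finset.mem_univ,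
    true_and, Finset.mem_insert, Finset.mem_singleton] at hx
  obtain ⟨⟨hi, hε⟩, hj, hδ⟩ := hx
  have hε0 : ε ≠ 0 := by rcases hε with rfl | rfl <;> decide
  have hδ0 : δ ≠ 0 := by rcases hδ with rfl | rfl <;> decide
  have hij : i ≠ j := by
    rintro rfl
    exact hε0 (by simpa using hj)
  exact ⟨hi, hε0, hj, hδ0, hij, by rwa [Function.update_of_ne hij.symm] at hj⟩

/-- Boundary of a boundary: each face of codimension two is reached by fixing its two coordinates in
either order, with opposite signs. -/
lemma sum_orient_mul_sum_orient (s : Fin n → SignType) (f : (Fin n → SignType) → ℤ) :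
    ∑ i ∈ Finset.univ.filter (fun i => s i = 0), ∑ ε ∈ ({1, -1} : Finset SignType),
      orient s i ε * ∑ j ∈ Finset.univ.filter (fun j => Function.update s i ε j = 0),
        ∑ δ ∈ ({1, -1} : Finset SignType), orient (Function.update s i ε) j δ *
          f (Function.update (Function.update s i ε) j δ) = 0 := by
  simp only [Finset.mul_sum, ← Finset.sum_product']
  rw [Finset.sum_sigma']
  refine Finset.sum_involution (fun x _ => ⟨x.2, x.1⟩) ?_ ?_ ?_ ?_
  · rintro ⟨⟨i, ε⟩, ⟨j, δ⟩⟩ hx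
    obtain ⟨hi, hε, hj, hδ, hij, hsj⟩ := mem_pairs hx
    dsimp only
    rw [Function.update_comm hij, ← mul_assoc, ← mul_assoc,
      orient_mul_orient_swap hi hsj hij hε hδ]
    ring
  · rintro ⟨⟨i, ε⟩, ⟨j, δ⟩⟩ hx - heq
    obtain ⟨hi, hε, hj, hδ, hij, hsj⟩ := mem_pairs hx
    exact hij (congrArg (fun x => x.2.1) heq)
  · rintro ⟨⟨i, ε⟩, ⟨j, δ⟩⟩ hx
    obtain ⟨hi, hε, hj, hδ, hij, hsj⟩ := mem_pairs hx
    simp only [Finset.mem_sigma, Finset.mem_product, Finset.mem_filter, Finset.mem_univ,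
      true_and] at hx ⊢
    exact ⟨⟨hsj, hx.2.2⟩, by rwa [Function.update_of_ne hij], hx.1.2⟩
  · rintro ⟨⟨i, ε⟩, ⟨j, δ⟩⟩ hx
    rfl

lemma faceIndex_zero_eq {I : Box (Fin n)} {lab : (Fin n → ℝ) → Fin (n + 1)}
    {s : Fin n → SignType} (h : ∀ v ∈ faceVertices I s, (lab v : ℕ) = 0) :
    faceIndex I lab 0 s = 1 := by
  rw [faceIndex, if_pos]
  ext j
  simp only [Set.mem_image, Set.mem_ofPred_eq]
  constructor
  · rintro ⟨v, hv, rfl⟩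
    exact (h v hv).le
  · intro hj
    obtain ⟨v, hv⟩ := faceVertices_nonempty I s
    exact ⟨v, hv, Fin.ext (by rw [h v hv]; omega)⟩

lemma facetSum_eq_zero {I : Box (Fin n)} {lab : (Fin n → ℝ) → Fin (n + 1)} {k : ℕ}
    {s : Fin n → SignType} (h : ∀ i ε, s i = 0 → ε ≠ 0 →
      faceIndex I lab k (Function.update s i ε) = 0) : facetSum I lab k s = 0 := by
  refine Finset.sum_eq_zero fun i hi => Finset.sum_eq_zero fun ε hε => ?_
  rw [h i ε (Finset.mem_filter.1 hi).2, mul_zero]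
  rintro rfl
  simp at hε

/-- A face whose labels are not the first `k + 2` labels and do not exceed `k + 1` either has
facets of index zero, or has only labels up to `k`. -/
lemma facetSum_eq_zero_or_le {I : Box (Fin n)} {lab : (Fin n → ℝ) → Fin (n + 1)} {k : ℕ}
    {s : Fin n → SignType} (h : ∀ v ∈ faceVertices I s, (lab v : ℕ) ≤ k + 1)
    (hs : lab '' faceVertices I s ≠ {j : Fin (n + 1) | (j : ℕ) ≤ k + 1}) :
    facetSum I lab k s = 0 ∨ ∀ v ∈ faceVertices I s, (lab v : ℕ) ≤ k := by
  by_contra! hc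
  obtain ⟨h0, v, hv, hvk⟩ := hc
  -- A facet of nonzero index carries all labels up to `k`; with the label `k + 1` of `v` the face
  -- would have them all.
  refine h0 (facetSum_eq_zero fun i ε hi _ => faceIndex_eq_zero fun heq => hs ?_)
  ext j
  simp only [Set.mem_image, Set.mem_ofPred_eq]
  constructor
  · rintro ⟨w, hw, rfl⟩
    exact h w hw
  · intro hj
    rcases Nat.le_or_eq_of_le_succ hj with hj | hj
    · obtain ⟨w, hw, rfl⟩ : j ∈ lab '' faceVertices I (Function.update s i ε) := heq ▸ hj
      exact ⟨w, faceVertices_update_subset I hi ε hw, rfl⟩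
    · exact ⟨v, hv, Fin.ext (by have := h v hv; omega)⟩

/-- The truncation in the definition of the index is immaterial as long as no label exceeds the
admissible ones. -/
theorem faceIndex_succ {I : Box (Fin n)} {lab : (Fin n → ℝ) → Fin (n + 1)} {k : ℕ}
    {s : Fin n → SignType} (h : ∀ v ∈ faceVertices I s, (lab v : ℕ) ≤ k + 1) :
    faceIndex I lab (k + 1) s = facetSum I lab k s := by
  induction k generalizing s with
  | zero =>
    by_cases hs : lab '' faceVertices I s = {j : Fin (n + 1) | (j : ℕ) ≤ 0 + 1}
    · exact faceIndex_succ_of_eq hs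
    rw [faceIndex_eq_zero hs]
    rcases facetSum_eq_zero_or_le h hs with h0 | h0
    · exact h0.symm
    -- Only the label 0 is left, so opposite facets both have index 1 and cancel.
    refine (Finset.sum_eq_zero fun i hi => ?_).symm
    have hi' := (Finset.mem_filter.1 hi).2
    have h1 (ε : SignType) : faceIndex I lab 0 (Function.update s i ε) = 1 :=
      faceIndex_zero_eq fun v hv => Nat.le_zero.1 (h0 v (faceVertices_update_subset I hi' ε hv))
    rw [Finset.sum_pair (by decide), h1, h1, orient_neg]
    ring
  | succ k ih =>
    by_cases hs : lab '' faceVertices I s = {j : Fin (n + 1) | (j : ℕ) ≤ k + 1 + 1}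
    · exact faceIndex_succ_of_eq hs
    rw [faceIndex_eq_zero hs]
    rcases facetSum_eq_zero_or_le h hs with h0 | h0
    · exact h0.symm
    -- The labels are now at most `k + 1`, so the induction hypothesis expands every facet and turns
    -- the facet sum into a double boundary.
    rw [← sum_orient_mul_sum_orient s (faceIndex I lab k), facetSum]
    refine Finset.sum_congr rfl fun i hi => Finset.sum_congr rfl fun ε _ => ?_
    have hi' := (Finset.mem_filter.1 hi).2
    rw [ih fun v hv => h0 v (faceVertices_update_subset I hi' ε hv), facetSum]

/-! ### Interior facets of a decomposition -/

lemma faceLower_update (I : Box (Fin n)) (i : Fin n) (ε : SignType) :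
    faceLower I (Function.update 0 i ε) =
      Function.update I.lower i (if ε = 1 then I.upper i else I.lower i) := by
  funext j
  by_cases hj : j = i
  · subst hj; simp [faceLower]
  · simp [faceLower, hj]

lemma faceUpper_update (I : Box (Fin n)) (i : Fin n) (ε : SignType) :
    faceUpper I (Function.update 0 i ε) =
      Function.update I.upper i (if ε = -1 then I.lower i else I.upper i) := by
  funext j
  by_cases hj : j = i
  · subst hj; simp [faceUpper]
  · simp [faceUpper, hj]

lemma interior_Icc_eq (I : Box (Fin n)) :
    interior (Box.Icc I) = Set.univ.pi fun i => Set.Ioo (I.lower i) (I.upper i) := by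
  rw [Box.Icc_def, ← Set.pi_univ_Icc, interior_pi_set Set.finite_univ]
  simp only [interior_Icc]

namespace IsCubicalDecomposition

variable {C : Box (Fin n)} {cells : Finset (Box (Fin n))}

lemma eq_of_overlap (h : IsCubicalDecomposition C cells) {I J : Box (Fin n)} (hI : I ∈ cells)
    (hJ : J ∈ cells) (hIJ : ∀ i, I.lower i < J.upper i ∧ J.lower i < I.upper i) : I = J := by
  by_contra hne
  have hk (i : Fin n) : ∃ x, (I.lower i < x ∧ x < I.upper i) ∧ (J.lower i < x ∧ x < J.upper i) := by
    obtain ⟨x, h1, h2⟩ := exists_between (a₁ := max (I.lower i) (J.lower i))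
      (a₂ := min (I.upper i) (J.upper i))
      (max_lt (lt_min (I.lower_lt_upper i) (hIJ i).1) (lt_min (hIJ i).2 (J.lower_lt_upper i)))
    exact ⟨x, ⟨(le_max_left _ _).trans_lt h1, h2.trans_le (min_le_left _ _)⟩,
      (le_max_right _ _).trans_lt h1, h2.trans_le (min_le_right _ _)⟩
  choose x hx using hk
  have := h.interior_disjoint I hI J hJ hne
  rw [interior_Icc_eq, interior_Icc_eq] at this
  exact Set.notMem_empty x (this ▸ ⟨fun i _ => (hx i).1, fun i _ => (hx i).2⟩)

/-- Both cells lie on the same side of the common facet, so they overlap. This makes the pairing of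
interior facets an involution. -/
lemma eq_of_facet_eq (h : IsCubicalDecomposition C cells) {I J : Box (Fin n)} (hI : I ∈ cells)
    (hJ : J ∈ cells) {i : Fin n} {ε : SignType} (hε : ε = 1 ∨ ε = -1)
    (hf : faceSet I (Function.update 0 i ε) = faceSet J (Function.update 0 i ε)) : I = J := by
  obtain ⟨hl, hu⟩ := faceLower_eq_and_faceUpper_eq hf
  simp only [faceLower_update, faceUpper_update] at hl hu
  refine h.eq_of_overlap hI hJ fun j => ?_
  have hlj := congrFun hl j
  have huj := congrFun hu j
  have h1 := I.lower_lt_upper j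
  have h2 := J.lower_lt_upper j
  by_cases hj : j = i
  · subst hj
    rcases hε with rfl | rfl <;> simp at hlj huj <;> constructor <;> linarith
  · simp [hj] at hlj huj
    constructor <;> linarith

lemma subset (h : IsCubicalDecomposition C cells) {I : Box (Fin n)} (hI : I ∈ cells) :
    Box.Icc I ⊆ Box.Icc C := by
  rw [← h.iUnion_eq]
  exact Set.subset_biUnion_of_mem (u := fun I : Box (Fin n) => (Box.Icc I : Set (Fin n → ℝ))) hI

/-- If a point of `C` can be moved inside `C` in direction `d`, then some cell contains the point
and a displaced point. -/
lemma exists_cell_of_eventually_mem (h : IsCubicalDecomposition C cells) (p d : Fin n → ℝ)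
    (hp : ∀ᶠ r in 𝓝[>] (0 : ℝ), p + r • d ∈ Box.Icc C) :
    ∃ J ∈ cells, p ∈ Box.Icc J ∧ ∃ r > (0 : ℝ), p + r • d ∈ Box.Icc J := by
  -- As finitely many cells cover `C`, one of them contains the displaced point for arbitrarily
  -- small `r`; being closed, it contains `p` too.
  have hfr : ∃ J ∈ cells, ∃ᶠ r in 𝓝[>] (0 : ℝ), p + r • d ∈ Box.Icc J := by
    by_contra! hc
    obtain ⟨r, hr, hr'⟩ := (hp.and ((Filter.eventually_all_finset cells).2 hc)).exists
    rw [← h.iUnion_eq, Set.mem_iUnion₂] at hr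
    obtain ⟨J, hJ, hrJ⟩ := hr
    exact hr' J hJ hrJ
  obtain ⟨J, hJ, hfr⟩ := hfr
  refine ⟨J, hJ, ?_, ?_⟩
  · have hcl : IsClosed (Box.Icc J : Set (Fin n → ℝ)) := by
      rw [Box.Icc_def]; exact isClosed_Icc
    have ht : Tendsto (fun r : ℝ => p + r • d) (𝓝[>] 0) (𝓝 p) := by
      have : Tendsto (fun r : ℝ => p + r • d) (𝓝 0) (𝓝 (p + (0 : ℝ) • d)) :=
        Continuous.tendsto (by fun_prop) 0
      rw [zero_smul, add_zero] at this
      exact this.mono_left nhdsWithin_le_nhds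
    exact hcl.mem_of_frequently_of_tendsto hfr ht
  · obtain ⟨r, hr, hr'⟩ := (hfr.and_eventually self_mem_nhdsWithin).exists
    exact ⟨r, hr', hr⟩

/-- If `c` were an end of the `i`-th side of `C`, the whole facet would lie in a facet of `C`. -/
lemma lt_and_lt_of_not_liesOnProperFace (h : IsCubicalDecomposition C cells) {I : Box (Fin n)}
    (hI : I ∈ cells) {i : Fin n} {ε : SignType}
    (hF : ¬ LiesOnProperFace C (faceSet I (Function.update 0 i ε))) (hε : ε ≠ 0) {c : ℝ}
    (hc : c = if ε = 1 then I.upper i else I.lower i) : C.lower i < c ∧ c < C.upper i := by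
  have hval {x : Fin n → ℝ} (hx : x ∈ faceSet I (Function.update 0 i ε)) : x i = c := by
    have := hx.2 i
    rw [Function.update_self] at this
    rcases ε with _ | _ | _
    · exact absurd rfl hε
    · rw [hc, if_neg (by decide)]; exact this.2 rfl
    · rw [hc, if_pos (by rfl)]; exact this.1 rfl
  have hcC : C.lower i ≤ c ∧ c ≤ C.upper i := by
    obtain ⟨x, hx, -⟩ := faceVertices_nonempty I (Function.update 0 i ε)
    rw [← hval hx]
    exact (mem_Icc_iff C x).1 (h.subset hI hx.1) i
  have hne {δ : SignType} (hδ : δ ≠ 0)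
      (hcδ : (δ = 1 → c = C.upper i) ∧ (δ = -1 → c = C.lower i)) : False := by
    refine hF ⟨Function.update 0 i δ, fun h0 => hδ (by simpa using congrFun h0 i), fun x hx =>
      ⟨h.subset hI hx.1, fun j => ?_⟩⟩
    by_cases hj : j = i
    · subst hj
      rw [Function.update_self, hval hx]
      exact hcδ
    · simp [hj]
  exact ⟨lt_of_le_of_ne hcC.1 fun he => hne (δ := -1) (by decide)
      ⟨fun h => absurd h (by decide), fun _ => he.symm⟩,
    lt_of_le_of_ne hcC.2 fun he => hne (δ := 1) (by decide)
      ⟨fun _ => he, fun h => absurd h (by decide)⟩⟩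

/-- A facet of a cell that does not lie on a proper face of `C` is the opposite facet of another
cell. -/
lemma exists_opposite (h : IsCubicalDecomposition C cells) {I : Box (Fin n)} (hI : I ∈ cells)
    {i : Fin n} {ε : SignType} (hε : ε = 1 ∨ ε = -1)
    (hF : ¬ LiesOnProperFace C (faceSet I (Function.update 0 i ε))) :
    ∃ J ∈ cells, faceSet J (Function.update 0 i (-ε)) = faceSet I (Function.update 0 i ε) := by
  have hε0 : ε ≠ 0 := by rcases hε with rfl | rfl <;> decide
  obtain ⟨c, hc⟩ : ∃ c, c = if ε = 1 then I.upper i else I.lower i := ⟨_, rfl⟩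
  obtain ⟨hc1, hc2⟩ := h.lt_and_lt_of_not_liesOnProperFace hI hF hε0 hc
  obtain ⟨e, he⟩ : ∃ e : ℝ, e = if ε = 1 then 1 else -1 := ⟨_, rfl⟩
  -- `p` is the centre of the facet and `e` the outward direction: moving from `p` along `e` leaves
  -- `I` but at first stays in `C`, and so finds the cell `J` across the facet.
  obtain ⟨p, hp⟩ : ∃ p : Fin n → ℝ,
      p = Function.update (fun j => (I.lower j + I.upper j) / 2) i c := ⟨_, rfl⟩
  have hpi : p i = c := by rw [hp, Function.update_self]
  have hpj {j : Fin n} (hj : j ≠ i) : I.lower j < p j ∧ p j < I.upper j := by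
    have := I.lower_lt_upper j
    rw [hp, Function.update_of_ne hj]
    constructor <;> linarith
  have hIi := I.lower_lt_upper i
  have hpI : p ∈ Box.Icc I := by
    rw [mem_Icc_iff]
    intro j
    by_cases hj : j = i
    · subst hj
      rw [hpi, hc]
      split_ifs <;> constructor <;> linarith
    · exact ⟨(hpj hj).1.le, (hpj hj).2.le⟩
  have hd (r : ℝ) : (p + r • Pi.single i e : Fin n → ℝ) i = c + r * e := by simp [hpi]
  have hdj (r : ℝ) {j : Fin n} (hj : j ≠ i) : (p + r • Pi.single i e : Fin n → ℝ) j = p j := by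
    simp [hj]
  obtain ⟨J, hJ, hpJ, r, hr, hrJ⟩ := h.exists_cell_of_eventually_mem p (Pi.single i e) (by
    have ht : Tendsto (fun r : ℝ => c + r * e) (𝓝[>] 0) (𝓝 c) := by
      have : Tendsto (fun r : ℝ => c + r * e) (𝓝 0) (𝓝 (c + 0 * e)) :=
        Continuous.tendsto (by fun_prop) 0
      rw [zero_mul, add_zero] at this
      exact this.mono_left nhdsWithin_le_nhds
    filter_upwards [ht.eventually (Ioo_mem_nhds hc1 hc2)] with r hr
    rw [mem_Icc_iff]
    intro j
    by_cases hj : j = i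
    · subst hj
      rw [hd]
      exact ⟨hr.1.le, hr.2.le⟩
    · rw [hdj r hj]
      exact (mem_Icc_iff C p).1 (h.subset hI hpI) j)
  have hrJi := (mem_Icc_iff J _).1 hrJ i
  rw [hd] at hrJi
  have hIJ : I ≠ J := by
    rintro rfl
    rcases hε with rfl | rfl <;> simp at hc he <;> subst he <;> linarith
  refine ⟨J, hJ, ?_⟩
  rcases h.inter_face I hI J hJ hIJ with h0 | ⟨s, t, hs, ht⟩
  · exact absurd (h0 ▸ ⟨hpI, hpJ⟩ : p ∈ (∅ : Set (Fin n → ℝ))) (Set.notMem_empty p)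
  have hps : p ∈ faceSet I s := hs ▸ ⟨hpI, hpJ⟩
  have hpt : p ∈ faceSet J t := ht ▸ ⟨hpI, hpJ⟩
  -- In every coordinate other than `i` the centre is strictly inside `I`, so a face of `I` through
  -- it can fix only coordinate `i`.
  have hsj {j : Fin n} (hj : j ≠ i) : s j = 0 := by
    have h1 := hps.2 j
    have h2 := hpj hj
    rcases hsj : s j with _ | _ | _
    · rfl
    · exact absurd (h1.2 hsj) h2.1.ne'
    · exact absurd (h1.1 hsj) h2.2.ne
  -- Otherwise the common face is all of `I`, giving `I ⊆ J` and overlapping interiors.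
  have hsi : s i ≠ 0 := by
    intro hsi
    have hs0 : s = 0 := by
      funext j
      by_cases hj : j = i
      · rw [hj, hsi]; rfl
      · exact hsj hj
    have hsub : Box.Icc I ⊆ Box.Icc J := by
      intro x hx
      have : x ∈ faceSet I s := ⟨hx, by simp [hs0]⟩
      rw [← hs] at this
      exact this.2
    rw [Box.Icc_def, Box.Icc_def, Set.Icc_subset_Icc_iff I.lower_le_upper] at hsub
    refine hIJ (h.eq_of_overlap hI hJ fun j => ?_)
    have h1 := hsub.1 j
    have h2 := hsub.2 j
    have h3 := I.lower_lt_upper j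
    constructor <;> linarith
  have hsε : s i = ε := by
    have h1 := hps.2 i
    rw [hpi] at h1
    rcases hε with rfl | rfl
    · simp at hc
      rcases hsi' : s i with _ | _ | _
      · exact absurd hsi' hsi
      · have := h1.2 hsi'
        linarith
      · rfl
    · simp at hc
      rcases hsi' : s i with _ | _ | _
      · exact absurd hsi' hsi
      · rfl
      · have := h1.1 hsi'
        linarith
  have hs' : s = Function.update (0 : Fin n → SignType) i ε := by
    funext j
    by_cases hj : j = i
    · subst hj; rw [hsε, Function.update_self]
    · rw [hsj hj, Function.update_of_ne hj]; rfl
  obtain ⟨hl, hu⟩ := faceLower_eq_and_faceUpper_eq (hs.symm.trans ht)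
  have hst (j : Fin n) : s j = 0 ↔ t j = 0 := by
    rw [← faceLower_lt_faceUpper_iff I, ← faceLower_lt_faceUpper_iff J, hl, hu]
  -- `J` extends beyond `p` in the outward direction, so `p` cannot lie on the `ε` side of `J`.
  have hti : t i = -ε := by
    have h1 := hpt.2 i
    have hti0 : t i ≠ 0 := (hst i).not.1 hsi
    rw [hpi] at h1
    rcases hε with rfl | rfl
    · simp at he
      subst he
      rcases hti' : t i with _ | _ | _
      · exact absurd hti' hti0
      · rfl
      · have := h1.1 hti'
        linarith
    · simp at he
      subst he
      rcases hti' : t i with _ | _ | _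
      · exact absurd hti' hti0
      · have := h1.2 hti'
        linarith
      · rfl
  have ht' : t = Function.update (0 : Fin n → SignType) i (-ε) := by
    funext j
    by_cases hj : j = i
    · subst hj; rw [hti, Function.update_self]
    · rw [(hst j).1 (hsj hj), Function.update_of_ne hj]; rfl
  rw [← ht', ← hs', ← hs, ← ht]

open Classical in
/-- The contributions of the facets that do not lie on proper faces of `C` cancel in pairs. -/
lemma sum_interior_facets (h : IsCubicalDecomposition C cells)
    (lab : (Fin n → ℝ) → Fin (n + 1)) (k : ℕ) :
    ∑ x ∈ (cells ×ˢ Finset.univ ×ˢ ({1, -1} : Finset SignType)).filter (fun x =>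
        ¬ LiesOnProperFace C (faceSet x.1 (Function.update 0 x.2.1 x.2.2))),
      orient 0 x.2.1 x.2.2 * faceIndex x.1 lab k (Function.update 0 x.2.1 x.2.2) = 0 := by
  obtain ⟨S, hS⟩ : ∃ S, S = (cells ×ˢ Finset.univ ×ˢ ({1, -1} : Finset SignType)).filter (fun x =>
      ¬ LiesOnProperFace C (faceSet x.1 (Function.update 0 x.2.1 x.2.2))) := ⟨_, rfl⟩
  rw [← hS]
  have hmem (x : Box (Fin n) × Fin n × SignType) : x ∈ S ↔ x.1 ∈ cells ∧
      (x.2.2 = 1 ∨ x.2.2 = -1) ∧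
        ¬ LiesOnProperFace C (faceSet x.1 (Function.update 0 x.2.1 x.2.2)) := by
    simp [hS, and_assoc]
  have hex : ∀ x ∈ S, ∃ J ∈ cells, faceSet J (Function.update 0 x.2.1 (-x.2.2)) =
      faceSet x.1 (Function.update 0 x.2.1 x.2.2) := fun x hx =>
    h.exists_opposite ((hmem x).1 hx).1 ((hmem x).1 hx).2.1 ((hmem x).1 hx).2.2
  choose! J hJ hJf using hex
  have hneg {ε : SignType} (hε : ε = 1 ∨ ε = -1) : -ε = 1 ∨ -ε = -1 := by
    rcases hε with rfl | rfl <;> decide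
  have hmem' (x) (hx : x ∈ S) : (J x, x.2.1, -x.2.2) ∈ S := by
    rw [hmem]
    dsimp only
    rw [hJf x hx]
    exact ⟨hJ x hx, hneg ((hmem x).1 hx).2.1, ((hmem x).1 hx).2.2⟩
  refine Finset.sum_involution (fun x _ => (J x, x.2.1, -x.2.2)) ?_ ?_ ?_ ?_
  · intro x hx
    obtain ⟨hl, hu⟩ := faceLower_eq_and_faceUpper_eq (hJf x hx)
    dsimp only
    rw [orient_neg, faceIndex_congr lab k hl hu]
    ring
  · intro x hx _ heq
    have hs : -x.2.2 = x.2.2 := congrArg (fun y => y.2.2) heq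
    rcases ((hmem x).1 hx).2.1 with h1 | h1 <;> rw [h1] at hs <;> exact absurd hs (by decide)
  · intro x hx
    exact hmem' x hx
  · intro x hx
    -- Crossing the facet twice gives a cell with the same facet on the same side as the original
    -- one.
    have h1 := (hJf _ (hmem' x hx)).trans (hJf x hx)
    dsimp only at h1
    rw [neg_neg] at h1
    have h2 := h.eq_of_facet_eq (hJ _ (hmem' x hx)) ((hmem x).1 hx).1 ((hmem x).1 hx).2.1 h1
    dsimp only
    rw [h2, neg_neg]

/-- The sum of the indices of the cells is the index of the decomposed cube, if all labels occur
on the boundary. -/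
theorem sum_cubeIndex_eq_tildeIndex {m : ℕ} {C : Box (Fin (m + 1))}
    {cells : Finset (Box (Fin (m + 1)))} (h : IsCubicalDecomposition C cells)
    (lab : (Fin (m + 1) → ℝ) → Fin (m + 1 + 1))
    (hlab : lab '' tildeVertices C cells = Set.univ) :
    ∑ I ∈ cells, cubeIndex I lab = tildeIndex C cells lab := by
  classical
  rw [tildeIndex, if_pos hlab, if_neg m.succ_ne_zero]
  have hcube (I : Box (Fin (m + 1))) : cubeIndex I lab =
      ∑ i, ∑ ε ∈ ({1, -1} : Finset SignType),
        orient 0 i ε * faceIndex I lab m (Function.update 0 i ε) := by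
    rw [cubeIndex, faceIndex_succ fun v _ => Nat.lt_succ_iff.1 (lab v).2, facetSum]
    simp
  have h0 := h.sum_interior_facets lab m
  rw [Finset.sum_filter] at h0
  simp only [Finset.sum_product] at h0
  -- The difference of the two sides is, term by term, the vanishing sum over interior facets.
  rw [← sub_eq_zero, ← h0, ← Finset.sum_sub_distrib]
  refine Finset.sum_congr rfl fun I _ => ?_
  rw [hcube, ← Finset.sum_sub_distrib]
  refine Finset.sum_congr rfl fun i _ => ?_
  rw [← Finset.sum_sub_distrib]
  refine Finset.sum_congr rfl fun ε _ => ?_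
  rw [Nat.add_sub_cancel]
  split_ifs <;> simp_all

lemma nonempty (h : IsCubicalDecomposition C cells) : cells.Nonempty := by
  have hC : C.lower ∈ Box.Icc C :=
    (mem_Icc_iff C _).2 fun i => ⟨le_rfl, (C.lower_lt_upper i).le⟩
  rw [← h.iUnion_eq, Set.mem_iUnion₂] at hC
  obtain ⟨I, hI, -⟩ := hC
  exact ⟨I, hI⟩

end IsCubicalDecomposition

/-! ### Complete labels -/

lemma image_faceVertices_of_cubeIndex_ne_zero {I : Box (Fin n)} {lab : (Fin n → ℝ) → Fin (n + 1)}
    (h : cubeIndex I lab ≠ 0) : lab '' faceVertices I 0 = Set.univ := by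
  by_contra hne
  refine h (faceIndex_eq_zero fun heq => hne (heq.trans (Set.eq_univ_of_forall fun j => ?_)))
  exact Nat.lt_succ_iff.1 j.2

/-- Choose a preimage in `L` of each `j`. Different values of `ψ` force different labels, and the
`j`-th hyperoctant lies in `N j`, while the cones meet only at 0. -/
lemma carriesComplete_of_image_eq_univ {ψ : VecLabel n → Fin (n + 1)} (hψ : IsChangeOfLabels ψ)
    {L : Set (VecLabel n)} (hL : ψ '' L = Set.univ) : CarriesComplete L := by
  obtain ⟨N, hN, hψN⟩ := hψ
  choose l hlL hl using fun j => (hL ▸ Set.mem_univ j : j ∈ ψ '' L)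
  refine ⟨l, fun j k hjk => by rw [← hl j, hjk, hl k], hlL, Set.Subset.antisymm ?_ ?_⟩
  · rw [← hN.iInter_eq]
    exact Set.iInter_mono fun j => (hψN (l j) j).2 (hl j)
  · rintro _ rfl
    exact Set.mem_iInter.2 fun j i => by simp

end CubicalSperner

theorem theorem3 (n : ℕ) (C : BoxIntegral.Box (Fin n)) (cells : Finset (BoxIntegral.Box (Fin n)))
    (hcells : CubicalSperner.IsCubicalDecomposition C cells)
    (φ : (Fin n → ℝ) → CubicalSperner.VecLabel n)
    (hφ : CubicalSperner.NonDegenerate C cells φ)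
    (ψ : CubicalSperner.VecLabel n → Fin (n + 1)) (hψ : CubicalSperner.IsChangeOfLabels ψ)
    (hind : CubicalSperner.tildeIndex C cells (ψ ∘ φ) ≠ 0) :
    ∃ I ∈ cells, CubicalSperner.cubeIndex I (ψ ∘ φ) ≠ 0 ∧
      CubicalSperner.CompletelyLabeled I φ := by
  suffices h : ∃ I ∈ cells, CubicalSperner.cubeIndex I (ψ ∘ φ) ≠ 0 by
    obtain ⟨I, hI, hne⟩ := h
    refine ⟨I, hI, hne, CubicalSperner.carriesComplete_of_image_eq_univ hψ ?_⟩
    rw [← Set.image_comp]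
    exact CubicalSperner.image_faceVertices_of_cubeIndex_ne_zero hne
  cases n with
  -- There are no facets to sum here; the only label is 0, so every cell has index 1.
  | zero =>
    obtain ⟨I, hI⟩ := hcells.nonempty
    refine ⟨I, hI, ?_⟩
    rw [CubicalSperner.cubeIndex, CubicalSperner.faceIndex_zero_eq fun v _ => by omega]
    exact one_ne_zero
  | succ m =>
    have hlab : (ψ ∘ φ) '' CubicalSperner.tildeVertices C cells = Set.univ := by
      by_contra hne
      exact hind (by rw [CubicalSperner.tildeIndex, if_neg hne])
    rw [← hcells.sum_cubeIndex_eq_tildeIndex _ hlab] at hind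
    exact Finset.exists_ne_zero_of_sum_ne_zero hind
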